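/- Let $X=(X_t)_{t\ge 0}$ be a standard one-dimensional Brownian motion started at $0$ (with almost surely continuous paths) on a probability space $(\Omega,\mathcal F,\mathbb P)$, let $p$ be an atomic proposition interpreted by $B_p=[1,\infty)$, and let $\tau_p(\omega)=\inf\{t\ge 0 : X_t(\omega)\ge 1\}\in[0,\infty]$. Formulas of metric temporal logic are built from atomic propositions by $\lnot\phi$, $\phi_1\wedge\phi_2$ and $\phi_1\,\mathcal U_I\,\phi_2$ with $I$ an interval of $[0,\infty)$; the formula is an MITL formula if every interval occurring in it has more than one point. For a path $x:[0,\infty)\to\mathbb R$, the continuous semantics is: $x,t\models p$ iff $x(t)\in B_p$; negation and conjunction are as usual; and $x,t\models\phi_1\mathcal U_I\phi_2$ iff there is $s\in I$ with $x,t+s\models\phi_2$ and $x,s'\models\phi_1$ for all $s'\in[t,t+s)$. For an integer $n\ge1$ and $t\in\mathbb N/n=\{k/n:k=0,1,2,\dots\}$, the discrete semantics $x,t\models_n\phi$ is defined by the same clauses, with $s$ restricted to $I\cap\mathbb N/n$ and $s'$ restricted to $[t,t+s)\cap\mathbb N/n$. Write $\Diamond_I\phi=\top\,\mathcal U_I\,\phi$,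 where $\top=\phi\vee\lnot\phi$ and $\phi_1\vee\phi_2=\lnot(\lnot\phi_1\wedge\lnot\phi_2)$, and $\Box_I\phi=\lnot\Diamond_I\lnot\phi$. Put $$\phi_1=\Box_{(1,2)}\bigl(\Diamond_{(1,4)}p\wedge\lnot\Diamond_{(1,3)}p\bigr),\qquad \phi_2=\Diamond_{(1,3)}\phi_1\wedge\lnot\Diamond_{(1,2)}\phi_1\wedge\lnot\Diamond_{(2,3)}\phi_1,$$ $$\phi_3=\Diamond_{(1,2)}\phi_2,\qquad \psi=\lnot p\wedge\lnot\Diamond_{(0,8)}p\wedge\phi_3 .$$ Then $\psi$ is an MITL formula, and: 1. the set $\{\omega : X(\omega),0\models\psi\}$ is measurable with respect to the $\mathbb P$-completion of $\mathcal F$, and $\mathbb P(\omega : X(\omega),0\models\psi)=\mathbb P(\omega : \tau_p(\omega)\in(8,9))>0$; 2. for every $n\ge 2$ and every $\omega\in\Omega$, $X(\omega),0\not\models_n\psi$; 3. consequently, $\mathbb P(\omega : X(\omega),0\models_n\psi)$ does not converge to $\mathbb P(\omega : X(\omega),0\models\psi)$ as $n\to\infty$. -/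

import Mathlib

open MeasureTheory ProbabilityTheory Filter Topology
open scoped NNReal ENNReal

/-- Formulas of metric temporal logic over the atomic propositions `AP`:
`φ ::= a | ¬ φ | φ₁ ∧ φ₂ | φ₁ U_I φ₂`, where `I` is an interval (an order-connected subset)
of `[0, ∞)`. -/
inductive MTL (AP : Type*) where
  | atom (a : AP) : MTL AP
  | neg (φ : MTL AP) : MTL AP
  | conj (φ₁ φ₂ : MTL AP) : MTL AP
  | untl (I : Set ℝ≥0) (hI : I.OrdConnected) (φ₁ φ₂ : MTL AP) : MTL AP

namespace MTL

variable {AP E : Type*}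

/-- `φ₁ ∨ φ₂ := ¬ (¬ φ₁ ∧ ¬ φ₂)`. -/
def disj (φ₁ φ₂ : MTL AP) : MTL AP := neg (conj (neg φ₁) (neg φ₂))

/-- The tautology `φ ∨ ¬ φ` built from a given formula `φ`. -/
def top (φ : MTL AP) : MTL AP := disj φ (neg φ)

/-- `◇_I φ := ⊤ U_I φ`. -/
def diamond (I : Set ℝ≥0) (hI : I.OrdConnected) (φ : MTL AP) : MTL AP :=
  untl I hI (top φ) φ

/-- `□_I φ := ¬ ◇_I ¬ φ`. -/
def box (I : Set ℝ≥0) (hI : I.OrdConnected) (φ : MTL AP) : MTL AP :=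
  neg (diamond I hI (neg φ))

/-- `◇_(a,b) φ`, for an open interval. -/
def diamondIoo (a b : ℝ≥0) (φ : MTL AP) : MTL AP :=
  diamond (Set.Ioo a b) Set.ordConnected_Ioo φ

/-- `□_(a,b) φ`, for an open interval. -/
def boxIoo (a b : ℝ≥0) (φ : MTL AP) : MTL AP :=
  box (Set.Ioo a b) Set.ordConnected_Ioo φ

/-- Metric interval temporal logic (MITL): every temporal operator in the formula carries an
interval with more than one point. -/
def IsMITL : MTL AP → Prop
  | atom _ => True
  | neg φ => φ.IsMITL
  | conj φ₁ φ₂ => φ₁.IsMITL ∧ φ₂.IsMITL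
  | untl I _ φ₁ φ₂ => I.Nontrivial ∧ φ₁.IsMITL ∧ φ₂.IsMITL

/-- Continuous semantics `x, t ⊨ φ` for a path `x : [0, ∞) → E`, where the atomic proposition `a`
is interpreted by the set `B a ⊆ E`. -/
def Sat (B : AP → Set E) (x : ℝ≥0 → E) : MTL AP → ℝ≥0 → Prop
  | atom a, t => x t ∈ B a
  | neg φ, t => ¬ Sat B x φ t
  | conj φ₁ φ₂, t => Sat B x φ₁ t ∧ Sat B x φ₂ t
  | untl I _ φ₁ φ₂, t =>
      ∃ s ∈ I, Sat B x φ₂ (t + s) ∧ ∀ s' ∈ Set.Ico t (t + s), Sat B x φ₁ s'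

/-- The time grid `ℕ/n = {k/n : k ∈ ℕ}`. -/
def timeGrid (n : ℕ) : Set ℝ≥0 := Set.range fun k : ℕ => (k : ℝ≥0) / (n : ℝ≥0)

/-- Discrete semantics `x, t ⊨ₙ φ`, meant for `n ≥ 1` and `t ∈ ℕ/n`. -/
def SatDiscrete (n : ℕ) (B : AP → Set E) (x : ℝ≥0 → E) : MTL AP → ℝ≥0 → Prop
  | atom a, t => x t ∈ B a
  | neg φ, t => ¬ SatDiscrete n B x φ t
  | conj φ₁ φ₂, t => SatDiscrete n B x φ₁ t ∧ SatDiscrete n B x φ₂ t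
  | untl I _ φ₁ φ₂, t =>
      ∃ s ∈ I ∩ timeGrid n, SatDiscrete n B x φ₂ (t + s) ∧
        ∀ s' ∈ Set.Ico t (t + s) ∩ timeGrid n, SatDiscrete n B x φ₁ s'

/-- `φ₁ := □_(1,2) (◇_(1,4) p ∧ ¬ ◇_(1,3) p)`. -/
def phi1 (p : AP) : MTL AP :=
  boxIoo 1 2 (conj (diamondIoo 1 4 (atom p)) (neg (diamondIoo 1 3 (atom p))))

/-- `φ₂ := ◇_(1,3) φ₁ ∧ ¬ ◇_(1,2) φ₁ ∧ ¬ ◇_(2,3) φ₁`. -/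
def phi2 (p : AP) : MTL AP :=
  conj (diamondIoo 1 3 (phi1 p))
    (conj (neg (diamondIoo 1 2 (phi1 p))) (neg (diamondIoo 2 3 (phi1 p))))

/-- `φ₃ := ◇_(1,2) φ₂`. -/
def phi3 (p : AP) : MTL AP := diamondIoo 1 2 (phi2 p)

/-- `ψ := ¬ p ∧ ¬ ◇_(0,8) p ∧ φ₃`. -/
def psi (p : AP) : MTL AP :=
  conj (neg (atom p)) (conj (neg (diamondIoo 0 8 (atom p))) (phi3 p))

end MTL

/-!
Write `S` for the set of times at which the path satisfies `p`, that is, lies in `[1, ∞)`. For a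
continuous path `S` is closed, and unfolding the semantics gives three equivalences: `φ₁` holds at
`t` iff `t + 5 ∈ S` and `S` misses `(t + 2, t + 5)` (`MTL.sat_phi1_iff`); `φ₂` holds at `t` iff
`φ₁` holds at `t + 2` (`MTL.sat_phi2_iff`), because a `p`-time preceded by a gap of length `3` is
isolated among such times; and `ψ` holds at `0` iff `S` misses `[0, 8]` but meets `[0, 9)`
(`MTL.sat_psi_iff`), i.e. iff the hitting time of `[1, ∞)` lies in `(8, 9)`.

On the grid `ℕ/n` the open intervals lose their end points, and `φ₁` at `t` only says that `p`
holds at one of the two grid points `t + 5 - 1/n`, `t + 5` after a gap. As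
`p` fails before time `8`, every relevant grid point at which `φ₁` holds therefore has a neighbour
at which it also holds, whereas `φ₂` requires an isolated one (`MTL.not_satDiscrete_psi`).

The event that a Brownian motion stays below a level on `[0, a]` is measurable up to null sets, as
it can be expressed through a countable dense set of times. The event `τ ∈ (8, 9)` has positive
probability: by Lévy's maximal inequality
(`ProbabilityTheory.IsPreBrownianReal.measure_exists_mem_finset_le`) and a passage to the limit
along a dense sequence, the path stays below `1 / 2` on `[0, 8]` with positive probability, and by
the weak Markov property it can then make a large independent upward jump before time `9`
(`ProbabilityTheory.IsBrownianReal.measure_forall_lt_and_exists_pos`). So the discrete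
probabilities vanish for `n ≥ 2`, while the continuous one does not.
-/

namespace MTL

variable {AP E : Type*}

/-! ### Semantics of the derived operators -/

lemma sat_diamondIoo (B : AP → Set E) (x : ℝ≥0 → E) (a b : ℝ≥0) (φ : MTL AP) (t : ℝ≥0) :
    Sat B x (diamondIoo a b φ) t ↔ ∃ u, t + a < u ∧ u < t + b ∧ Sat B x φ u := by
  simp only [diamondIoo, diamond, top, disj, Sat, Set.mem_Ioo]
  constructor
  · rintro ⟨s, ⟨h1, h2⟩, h, -⟩
    exact ⟨t + s, by gcongr, by gcongr, h⟩
  · rintro ⟨u, h1, h2, h⟩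
    obtain ⟨s, rfl⟩ := le_iff_exists_add.1 ((le_add_right le_rfl).trans h1.le : t ≤ u)
    exact ⟨s, ⟨lt_of_add_lt_add_left h1, lt_of_add_lt_add_left h2⟩, h, fun _ _ => by tauto⟩

lemma sat_boxIoo (B : AP → Set E) (x : ℝ≥0 → E) (a b : ℝ≥0) (φ : MTL AP) (t : ℝ≥0) :
    Sat B x (boxIoo a b φ) t ↔ ∀ u, t + a < u → u < t + b → Sat B x φ u := by
  have h := sat_diamondIoo B x a b (neg φ) t
  simp only [diamondIoo, Sat] at h
  simp only [boxIoo, box, Sat, h]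
  push Not
  rfl

lemma satDiscrete_diamondIoo {n : ℕ} (hn : 0 < n) (B : AP → Set E) (x : ℝ≥0 → E) (a b : ℕ)
    (φ : MTL AP) (k : ℕ) :
    SatDiscrete n B x (diamondIoo a b φ) (k / n) ↔
      ∃ j : ℕ, k + a * n < j ∧ j < k + b * n ∧ SatDiscrete n B x φ (j / n) := by
  have hn' : (0 : ℝ≥0) < n := by exact_mod_cast hn
  simp only [diamondIoo, diamond, top, disj, SatDiscrete, timeGrid, Set.mem_Ioo, Set.mem_inter_iff,
    Set.mem_range]
  constructor
  · rintro ⟨_, ⟨⟨h1, h2⟩, i, rfl⟩, h, -⟩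
    rw [lt_div_iff₀ hn'] at h1
    rw [div_lt_iff₀ hn'] at h2
    norm_cast at h1 h2
    refine ⟨k + i, by lia, by lia, ?_⟩
    rwa [Nat.cast_add, add_div]
  · rintro ⟨j, h1, h2, h⟩
    obtain ⟨i, rfl⟩ := Nat.exists_eq_add_of_le (show k ≤ j by lia)
    refine ⟨(i : ℝ≥0) / n, ⟨⟨?_, ?_⟩, i, rfl⟩, ?_, fun _ _ => by tauto⟩
    · rw [lt_div_iff₀ hn']
      exact_mod_cast (by lia : a * n < i)
    · rw [div_lt_iff₀ hn']
      exact_mod_cast (by lia : i < b * n)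
    · rwa [← add_div, ← Nat.cast_add]

lemma satDiscrete_boxIoo {n : ℕ} (hn : 0 < n) (B : AP → Set E) (x : ℝ≥0 → E) (a b : ℕ)
    (φ : MTL AP) (k : ℕ) :
    SatDiscrete n B x (boxIoo a b φ) (k / n) ↔
      ∀ j : ℕ, k + a * n < j → j < k + b * n → SatDiscrete n B x φ (j / n) := by
  have h := satDiscrete_diamondIoo hn B x a b (neg φ) k
  simp only [diamondIoo, SatDiscrete] at h
  simp only [boxIoo, box, SatDiscrete, h]
  push Not
  rfl

lemma IsMITL.diamondIoo {a b : ℝ≥0} (hab : a < b) {φ : MTL AP} (hφ : φ.IsMITL) :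
    (diamondIoo a b φ).IsMITL :=
  ⟨Set.Ioo_infinite hab |>.nontrivial, ⟨hφ, hφ⟩, hφ⟩

lemma IsMITL.boxIoo {a b : ℝ≥0} (hab : a < b) {φ : MTL AP} (hφ : φ.IsMITL) :
    (boxIoo a b φ).IsMITL :=
  IsMITL.diamondIoo (φ := neg φ) hab hφ

lemma isMITL_psi (p : AP) : (psi p).IsMITL := by
  have h1 : (phi1 p).IsMITL :=
    .boxIoo (by norm_num) ⟨.diamondIoo (by norm_num) trivial, .diamondIoo (by norm_num) trivial⟩
  have h2 : (phi2 p).IsMITL :=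
    ⟨.diamondIoo (by norm_num) h1, .diamondIoo (by norm_num) h1, .diamondIoo (by norm_num) h1⟩
  exact ⟨trivial, .diamondIoo (by norm_num) trivial, .diamondIoo (by norm_num) h2⟩

/-! ### Continuous semantics along a path with a closed set of `p`-times -/

/-- Letting the left end of the window `(u + 1, u + 4)` tend to `t + 2` forces a `p`-time in every
interval `[t + 5, t + 5 + ε)`, and closedness turns this into a `p`-time at exactly `t + 5`. -/
lemma sat_phi1_iff {B : AP → Set E} {x : ℝ≥0 → E} {p : AP} (hS : IsClosed {u | x u ∈ B p})
    (t : ℝ≥0) :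
    Sat B x (phi1 p) t ↔ x (t + 5) ∈ B p ∧ ∀ u, t + 2 < u → u < t + 5 → x u ∉ B p := by
  simp only [phi1, sat_boxIoo, Sat, sat_diamondIoo, not_exists, not_and]
  constructor
  · intro h
    have hgap : ∀ u, t + 2 < u → u < t + 5 → x u ∉ B p := by
      intro u h1 h2
      -- The affine map sending `(t + 2, t + 5)` onto `(t + 1, t + 2)` yields a window
      -- `(v + 1, v + 3)` around `u`.
      refine (h ((2 * t + 1 + u) / 3) ?_ ?_).2 u ?_ ?_ <;>
      · rw [← NNReal.coe_lt_coe] at *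
        push_cast at *
        linarith
    refine ⟨by_contra fun h5 => ?_, hgap⟩
    obtain ⟨e, he, hsub⟩ := exists_Ico_subset_of_mem_nhds (hS.isOpen_compl.mem_nhds h5)
      ⟨t + 6, by gcongr; norm_num⟩
    obtain ⟨d, rfl⟩ := le_iff_exists_add.1 he.le
    have hd : 0 < d := pos_of_lt_add_right he
    have hm : 0 < min d 1 := lt_min hd one_pos
    obtain ⟨w, hw1, hw2, hw⟩ := (h (t + 1 + min d 1 / 2)
      (by rw [← NNReal.coe_lt_coe] at *; push_cast at *; linarith)
      (by
        have := min_le_right d 1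
        rw [← NNReal.coe_lt_coe] at *; rw [← NNReal.coe_le_coe] at this
        push_cast at *; linarith)).1
    rcases lt_or_ge w (t + 5) with h' | h'
    · refine hgap w ?_ h' hw
      rw [← NNReal.coe_lt_coe] at *; push_cast at *; linarith
    · refine hsub ⟨h', ?_⟩ hw
      have := min_le_left d 1
      rw [← NNReal.coe_lt_coe] at *; rw [← NNReal.coe_le_coe] at this
      push_cast at *; linarith
  · rintro ⟨h5, hgap⟩ u h1 h2
    refine ⟨⟨t + 5, ?_, ?_, h5⟩, fun w h3 h4 => hgap w ?_ ?_⟩ <;>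
    · rw [← NNReal.coe_lt_coe] at *
      push_cast at *
      linarith

lemma sat_phi2_iff {B : AP → Set E} {x : ℝ≥0 → E} {p : AP} (hS : IsClosed {u | x u ∈ B p})
    (t : ℝ≥0) :
    Sat B x (phi2 p) t ↔ x (t + 7) ∈ B p ∧ ∀ u, t + 4 < u → u < t + 7 → x u ∉ B p := by
  have key : Sat B x (phi1 p) (t + 2) ↔
      x (t + 7) ∈ B p ∧ ∀ u, t + 4 < u → u < t + 7 → x u ∉ B p := by
    rw [sat_phi1_iff hS, add_assoc, add_assoc]
    norm_num
  simp only [phi2, Sat, sat_diamondIoo, not_exists, not_and]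
  constructor
  · rintro ⟨⟨u, h1, h2, hu⟩, h3, h4⟩
    rcases lt_trichotomy u (t + 2) with h | rfl | h
    · exact absurd hu (h3 u h1 h)
    · exact key.1 hu
    · exact absurd hu (h4 u h h2)
  · intro h
    refine ⟨⟨t + 2, by gcongr; norm_num, by gcongr; norm_num, key.2 h⟩, ?_, ?_⟩
    · intro u h1 h2 hu
      refine h.2 (u + 5) ?_ ?_ ((sat_phi1_iff hS u).1 hu).1 <;>
      · rw [← NNReal.coe_lt_coe] at *
        push_cast at *
        linarith
    · intro u h1 h2 hu
      refine ((sat_phi1_iff hS u).1 hu).2 (t + 7) ?_ ?_ h.1 <;>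
      · rw [← NNReal.coe_lt_coe] at *
        push_cast at *
        linarith

/-- Along a path with a closed set of `p`-times, `ψ` says that the first `p`-time lies in
`(8, 9)`. -/
lemma sat_psi_iff {B : AP → Set E} {x : ℝ≥0 → E} {p : AP} (hS : IsClosed {u | x u ∈ B p}) :
    Sat B x (psi p) 0 ↔ (∀ u ≤ 8, x u ∉ B p) ∧ ∃ u < 9, x u ∈ B p := by
  simp only [psi, phi3, Sat, sat_diamondIoo, not_exists, not_and, zero_add, sat_phi2_iff hS]
  constructor
  · rintro ⟨h0, h8, t, h1, h2, ht, hgap⟩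
    refine ⟨fun u hu => ?_, t + 7, ?_, ht⟩
    · rcases hu.lt_or_eq with hu | rfl
      · rcases eq_zero_or_pos u with rfl | hu0
        exacts [h0, h8 u hu0 hu]
      · refine hgap 8 ?_ ?_ <;>
        · rw [← NNReal.coe_lt_coe] at *
          push_cast at *
          linarith
    · rw [← NNReal.coe_lt_coe] at *
      push_cast at *
      linarith
  · rintro ⟨h8, u, hu9, hu⟩
    obtain ⟨r, hr, hmin⟩ : ∃ r, x r ∈ B p ∧ ∀ v < r, x v ∉ B p :=
      ⟨sInf {u | x u ∈ B p}, hS.csInf_mem ⟨u, hu⟩ (OrderBot.bddBelow _),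
        fun v hv hv' => hv.not_ge (csInf_le (OrderBot.bddBelow _) hv')⟩
    have hr9 : r < 9 := (not_lt.1 fun h => hmin u h hu).trans_lt hu9
    have hr8 : 8 < r := not_le.1 fun h => h8 r h hr
    obtain ⟨t, rfl⟩ := le_iff_exists_add'.1 ((by norm_num : (7 : ℝ≥0) ≤ 8).trans hr8.le)
    refine ⟨h8 0 zero_le, fun v _ hv => h8 v hv.le, t, ?_, ?_, hr, fun v _ hv => hmin v hv⟩ <;>
    · rw [← NNReal.coe_lt_coe] at *
      push_cast at *
      linarith

/-! ### Discrete semantics -/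

/-- On the grid, `φ₁` only locates a `p`-time within the two grid points `t + 5 - 1/n`
and `t + 5`. -/
lemma satDiscrete_phi1_iff {n : ℕ} (hn : 2 ≤ n) (B : AP → Set E) (x : ℝ≥0 → E) (p : AP) (k : ℕ) :
    SatDiscrete n B x (phi1 p) (k / n) ↔
      (x ((k + 5 * n - 1 : ℕ) / n) ∈ B p ∨ x ((k + 5 * n : ℕ) / n) ∈ B p) ∧
      ∀ w : ℕ, k + 2 * n + 1 < w → w + 1 < k + 5 * n → x (w / n) ∉ B p := by
  have hn0 : 0 < n := by lia
  have hd := satDiscrete_diamondIoo hn0 B x 1 4 (atom p)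
  have hd' := satDiscrete_diamondIoo hn0 B x 1 3 (atom p)
  have hb := satDiscrete_boxIoo hn0 B x 1 2
    (conj (diamondIoo 1 4 (atom p)) (neg (diamondIoo 1 3 (atom p)))) k
  simp only [Nat.cast_one, Nat.cast_ofNat] at hd hd' hb
  simp only [phi1, hb, SatDiscrete, hd, hd', not_exists, not_and]
  constructor
  · intro h
    have hgap : ∀ w : ℕ, k + 2 * n + 1 < w → w + 1 < k + 5 * n → x (w / n) ∉ B p :=
      fun w h1 h2 =>
        (h (max (k + n + 1) (w + 1 - 3 * n)) (by lia) (by lia)).2 w (by lia) (by lia)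
    refine ⟨?_, hgap⟩
    obtain ⟨w, h1, h2, hw⟩ := (h (k + n + 1) (by lia) (by lia)).1
    have h3 : ¬ w + 1 < k + 5 * n := fun h' => hgap w (by lia) h' hw
    obtain rfl | rfl : w = k + 5 * n - 1 ∨ w = k + 5 * n := by lia
    exacts [.inl hw, .inr hw]
  · rintro ⟨h5, hgap⟩ u h1 h2
    refine ⟨?_, fun w h3 h4 => hgap w (by lia) (by lia)⟩
    rcases h5 with h5 | h5
    exacts [⟨_, by lia, by lia, h5⟩, ⟨_, by lia, by lia, h5⟩]

/-- `φ₂` asks for a grid time at which `φ₁` holds, while `φ₁` fails at its two neighbours. But if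
`φ₁` holds through a `p`-time in the first of the two admissible grid points, it also holds one
step earlier, as there is no `p`-time before `8`; otherwise it also holds one step later. -/
lemma not_satDiscrete_psi {n : ℕ} (hn : 2 ≤ n) (B : AP → Set E) (x : ℝ≥0 → E) (p : AP) :
    ¬ SatDiscrete n B x (psi p) 0 := by
  have hn0 : 0 < n := by lia
  have h08 := satDiscrete_diamondIoo hn0 B x 0 8 (atom p) 0
  have h12 := fun φ => satDiscrete_diamondIoo hn0 B x 1 2 φ
  have h13 := fun φ => satDiscrete_diamondIoo hn0 B x 1 3 φ
  have h23 := fun φ => satDiscrete_diamondIoo hn0 B x 2 3 φ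
  have h3 := h12 (phi2 p) 0
  simp only [Nat.cast_zero, Nat.cast_one, Nat.cast_ofNat, zero_div] at h08 h12 h13 h23 h3
  simp only [psi, phi3, SatDiscrete, h08, h3, not_exists, not_and]
  simp only [phi2, SatDiscrete, h12, h13, h23, not_exists, not_and]
  rintro - h8 j hj1 hj2 ⟨i, hi1, hi2, hi⟩ hl hr
  obtain rfl : i = j + 2 * n := by
    rcases lt_trichotomy i (j + 2 * n) with h | h | h
    · exact absurd hi (hl i hi1 h)
    · exact h
    · exact absurd hi (hr i h hi2)
  rw [satDiscrete_phi1_iff hn] at hi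
  obtain ⟨h5, hgap⟩ := hi
  by_cases hp : x ((j + 2 * n + 5 * n - 1 : ℕ) / n) ∈ B p
  · refine hl (j + 2 * n - 1) (by lia) (by lia) ((satDiscrete_phi1_iff hn B x p _).2 ⟨.inr ?_, ?_⟩)
    · rwa [show j + 2 * n - 1 + 5 * n = j + 2 * n + 5 * n - 1 by lia]
    · intro w hw1 hw2
      -- The only new grid point in the gap precedes time `8`.
      rcases (show j + 2 * n + 2 * n + 1 ≤ w by lia).eq_or_lt with rfl | h
      · exact h8 _ (by lia) (by lia)
      · exact hgap w h (by lia)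
  · refine hr (j + 2 * n + 1) (by lia) (by lia)
      ((satDiscrete_phi1_iff hn B x p _).2 ⟨.inl ?_, ?_⟩)
    · rw [show j + 2 * n + 1 + 5 * n - 1 = j + 2 * n + 5 * n by lia]
      exact h5.resolve_left hp
    · intro w hw1 hw2
      rcases (show w + 1 ≤ j + 2 * n + 5 * n by lia).eq_or_lt with h | h
      · rwa [show w = j + 2 * n + 5 * n - 1 by lia]
      · exact hgap w (by lia) h

end MTL

namespace ProbabilityTheory

/-! ### Centred Gaussian laws -/

lemma gaussianReal_Iic_neg (v : ℝ≥0) (c : ℝ) :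
    gaussianReal 0 v (Set.Iic (-c)) = gaussianReal 0 v (Set.Ici c) := by
  conv_rhs => rw [← neg_zero, ← gaussianReal_map_neg,
    Measure.map_apply measurable_neg measurableSet_Ici]
  congr 1
  ext x
  simp

lemma one_le_two_mul_gaussianReal_Ici_zero (v : ℝ≥0) :
    1 ≤ 2 * gaussianReal 0 v (Set.Ici 0) := by
  calc (1 : ℝ≥0∞) = gaussianReal 0 v (Set.Iic 0 ∪ Set.Ici 0) := by
        rw [Set.Iic_union_Ici, measure_univ]
    _ ≤ gaussianReal 0 v (Set.Iic 0) + gaussianReal 0 v (Set.Ici 0) := measure_union_le _ _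
    _ = 2 * gaussianReal 0 v (Set.Ici 0) := by
        rw [← gaussianReal_Iic_neg v 0, neg_zero, two_mul]

lemma gaussianReal_pos_of_isOpen {v : ℝ≥0} (hv : v ≠ 0) {U : Set ℝ} (hU : IsOpen U)
    (hne : U.Nonempty) : 0 < gaussianReal 0 v U :=
  pos_iff_ne_zero.2 fun h =>
    hU.measure_ne_zero volume hne (gaussianReal_absolutelyContinuous' 0 hv h)

lemma two_mul_gaussianReal_Ici_lt_one {v : ℝ≥0} (hv : v ≠ 0) {c : ℝ} (hc : 0 < c) :
    2 * gaussianReal 0 v (Set.Ici c) < 1 := by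
  have hpos := gaussianReal_pos_of_isOpen hv isOpen_Ioo
    (Set.nonempty_Ioo.2 (neg_lt_self hc))
  have hd1 : Disjoint (Set.Iic (-c)) (Set.Ici c) := Set.Iic_disjoint_Ici.2 (by linarith)
  have hd2 : Disjoint (Set.Iic (-c) ∪ Set.Ici c) (Set.Ioo (-c) c) := by
    rw [Set.disjoint_left]
    rintro x (h | h) ⟨h1, h2⟩
    exacts [h1.not_ge h, h2.not_ge h]
  calc 2 * gaussianReal 0 v (Set.Ici c)
      = gaussianReal 0 v (Set.Iic (-c) ∪ Set.Ici c) := by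
        rw [measure_union hd1 measurableSet_Ici, gaussianReal_Iic_neg, two_mul]
    _ < gaussianReal 0 v (Set.Iic (-c) ∪ Set.Ici c) + gaussianReal 0 v (Set.Ioo (-c) c) :=
        ENNReal.lt_add_right (measure_ne_top _ _) hpos.ne'
    _ = gaussianReal 0 v ((Set.Iic (-c) ∪ Set.Ici c) ∪ Set.Ioo (-c) c) :=
        (measure_union hd2 measurableSet_Ioo).symm
    _ ≤ 1 := prob_le_one

/-! ### Brownian motion stays below a positive level with positive probability -/

section Brownian

variable {Ω : Type*} [MeasurableSpace Ω] {P : Measure Ω} {X : ℝ≥0 → Ω → ℝ}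

lemma IsPreBrownianReal.measure_sub_mem (hX : IsPreBrownianReal X P) (s t : ℝ≥0) {U : Set ℝ}
    (hU : MeasurableSet U) :
    P {ω | X s ω - X t ω ∈ U} = gaussianReal 0 (nndist s.1 t.1) U :=
  (hX.hasLaw_sub s t).measure_eq (p := (· ∈ U)) hU

/-- Lévy's maximal inequality over finitely many times. Decomposing according to the first time
`t` at which the level `c` is reached, the independent symmetric increment `X a - X t` is
nonnegative with probability at least `1 / 2`. -/
lemma IsPreBrownianReal.measure_exists_mem_finset_le (hX : IsPreBrownianReal X P) (a : ℝ≥0)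
    (c : ℝ) (T : Finset ℝ≥0) (hT : ∀ t ∈ T, t ≤ a) :
    P {ω | ∃ t ∈ T, c ≤ X t ω} ≤ 2 * P {ω | c ≤ X a ω} := by
  set F : ℝ≥0 → Set Ω := fun t => {ω | c ≤ X t ω ∧ ∀ s ∈ T, s < t → X s ω < c} with hF
  set D : ℝ≥0 → Set Ω := fun t => {ω | X a ω - X t ω ∈ Set.Ici 0} with hD
  have hle t : NullMeasurableSet {ω | c ≤ X t ω} P :=
    nullMeasurableSet_le aemeasurable_const (hX.aemeasurable t)
  have hFm t : NullMeasurableSet (F t) P := by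
    have : F t = {ω | c ≤ X t ω} ∩ ⋂ s ∈ T, ⋂ (_ : s < t), {ω | X s ω < c} := by
      ext ω
      simp [hF]
    rw [this]
    refine (hle t).inter (.biInter T.countable_toSet fun s _ => .iInter fun _ => ?_)
    exact nullMeasurableSet_lt (hX.aemeasurable s) aemeasurable_const
  have hDm t : NullMeasurableSet (D t) P :=
    ((hX.aemeasurable a).sub (hX.aemeasurable t)).nullMeasurableSet_preimage measurableSet_Ici
  have hindep : ∀ t ∈ T, P (D t ∩ F t) = P (D t) * P (F t) := by
    intro t ht
    obtain ⟨r, rfl⟩ := le_iff_exists_add.1 (hT t ht)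
    have h := (hX.indepFun_shift t).measure_inter_preimage_eq_mul {f | f r ∈ Set.Ici 0}
      {g | c ≤ g ⟨t, Set.self_mem_Iic⟩ ∧ ∀ s ∈ T, ∀ hs : s < t, g ⟨s, hs.le⟩ < c}
      (measurableSet_Ici.preimage (measurable_pi_apply r)) ?_
    · exact h
    · have : {g : Set.Iic t → ℝ | c ≤ g ⟨t, Set.self_mem_Iic⟩ ∧ ∀ s ∈ T, ∀ hs : s < t, g ⟨s, hs.le⟩ < c} =
          {g | c ≤ g ⟨t, Set.self_mem_Iic⟩} ∩ ⋂ s ∈ T, ⋂ hs : s < t, {g | g ⟨s, hs.le⟩ < c} := by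
        ext g
        simp
      rw [this]
      refine (measurableSet_le measurable_const (measurable_pi_apply _)).inter
        (.biInter T.countable_toSet fun s _ => .iInter fun _ => ?_)
      exact measurableSet_lt (measurable_pi_apply _) measurable_const
  have hdisj : Set.Pairwise (T : Set ℝ≥0) (Function.onFun (AEDisjoint P) fun t => D t ∩ F t) := by
    intro s hs t ht hst
    refine Disjoint.aedisjoint (Set.disjoint_left.2 ?_)
    rintro ω ⟨-, h1, h2⟩ ⟨-, h3, h4⟩
    rcases hst.lt_or_gt with h | h
    exacts [(h4 s hs h).not_ge h1, (h2 t ht h).not_ge h3]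
  calc P {ω | ∃ t ∈ T, c ≤ X t ω}
      ≤ P (⋃ t ∈ T, F t) := by
        refine measure_mono fun ω ⟨t, ht, htc⟩ => ?_
        obtain ⟨m, hm, hmin⟩ := (T.filter fun t => c ≤ X t ω).exists_minimal
          ⟨t, Finset.mem_filter.2 ⟨ht, htc⟩⟩
        rw [Finset.mem_filter] at hm
        refine Set.mem_biUnion hm.1 ⟨hm.2, fun s hs hsm => not_le.1 fun hc => ?_⟩
        exact hsm.not_ge (hmin (Finset.mem_filter.2 ⟨hs, hc⟩) hsm.le)
    _ ≤ ∑ t ∈ T, P (F t) := measure_biUnion_finset_le _ _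
    _ ≤ ∑ t ∈ T, 2 * P (D t ∩ F t) := by
        refine Finset.sum_le_sum fun t ht => ?_
        rw [hindep t ht, ← mul_assoc, hX.measure_sub_mem a t measurableSet_Ici]
        exact le_mul_of_one_le_left' (one_le_two_mul_gaussianReal_Ici_zero _)
    _ = 2 * P (⋃ t ∈ T, D t ∩ F t) := by
        rw [measure_biUnion_finset₀ hdisj fun t _ => (hDm t).inter (hFm t), Finset.mul_sum]
    _ ≤ 2 * P {ω | c ≤ X a ω} := by
        gcongr
        refine Set.iUnion₂_subset fun t _ ω hω => ?_
        have h1 : 0 ≤ X a ω - X t ω := hω.1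
        have h2 : c ≤ X t ω := hω.2.1
        exact (show c ≤ X a ω by linarith)

lemma IsPreBrownianReal.measure_forall_seq_lt_pos (hX : IsPreBrownianReal X P) {a : ℝ≥0}
    (ha : a ≠ 0) {c : ℝ} (hc : 0 < c) (q : ℕ → ℝ≥0) :
    0 < P {ω | ∀ k, q k ≤ a → X (q k) ω < c} := by
  have : IsProbabilityMeasure P := hX.isGaussianProcess.isProbabilityMeasure
  set G : ℕ → Set Ω := fun m => {ω | ∃ t ∈ ((Finset.range m).image q).filter (· ≤ a), c ≤ X t ω}
    with hG
  have hmono : Monotone G := by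
    intro m n hmn ω ⟨t, ht, h⟩
    refine ⟨t, ?_, h⟩
    simp only [Finset.mem_filter, Finset.mem_image, Finset.mem_range] at ht ⊢
    obtain ⟨⟨i, hi, rfl⟩, hta⟩ := ht
    exact ⟨⟨i, hi.trans_le hmn, rfl⟩, hta⟩
  have hcompl : {ω | ∀ k, q k ≤ a → X (q k) ω < c} = (⋃ m, G m)ᶜ := by
    ext ω
    simp only [hG, Set.mem_ofPred_eq, Set.mem_compl_iff, Set.mem_iUnion, Finset.mem_filter,
      Finset.mem_image, Finset.mem_range, not_exists, not_and, not_le]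
    constructor
    · rintro h m t ⟨⟨i, hi, rfl⟩, hta⟩
      exact h i hta
    · intro h k hk
      exact h (k + 1) (q k) ⟨⟨k, by lia, rfl⟩, hk⟩
  have hlt : P (⋃ m, G m) < 1 := by
    rw [hmono.measure_iUnion]
    refine (iSup_le fun m => hX.measure_exists_mem_finset_le a c _
      fun t ht => (Finset.mem_filter.1 ht).2).trans_lt ?_
    rw [(hX.hasLaw_eval a).measure_eq (p := (c ≤ ·)) measurableSet_Ici]
    exact two_mul_gaussianReal_Ici_lt_one ha hc
  rw [hcompl, pos_iff_ne_zero]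
  intro h
  have h1 : (1 : ℝ≥0∞) ≤ P (⋃ m, G m) + P (⋃ m, G m)ᶜ := by
    rw [← measure_univ (μ := P), ← Set.union_compl_self (⋃ m, G m)]
    exact measure_union_le _ _
  rw [h, add_zero] at h1
  exact hlt.not_ge h1

lemma forall_le_of_forall_seq_le {f : ℝ≥0 → ℝ} (hf : Continuous f) {a : ℝ≥0} (ha : a ≠ 0)
    {q : ℕ → ℝ≥0} (hq : DenseRange q) {c : ℝ} (h : ∀ k, q k ≤ a → f (q k) ≤ c) :
    ∀ t ≤ a, f t ≤ c := by
  have hsub : closure (Set.Iio a ∩ Set.range q) ⊆ {t | f t ≤ c} := by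
    refine closure_minimal ?_ (isClosed_le hf continuous_const)
    rintro _ ⟨h1, k, rfl⟩
    exact h k (le_of_lt h1)
  intro t ht
  refine hsub (closure_minimal (hq.open_subset_closure_inter isOpen_Iio) isClosed_closure ?_)
  rw [closure_Iio' ⟨0, pos_iff_ne_zero.2 ha⟩]
  exact ht

lemma IsBrownianReal.nullMeasurableSet_forall_lt (hX : IsBrownianReal X P) {a : ℝ≥0} (ha : a ≠ 0)
    (c : ℝ) : NullMeasurableSet {ω | ∀ t ≤ a, X t ω < c} P := by
  set q := TopologicalSpace.denseSeq ℝ≥0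
  have hm : NullMeasurableSet
      (⋃ m : ℕ, ⋂ k : ℕ, ⋂ (_ : q k ≤ a), {ω | X (q k) ω ≤ c - 1 / (m + 1 : ℝ)}) P :=
    .iUnion fun m => .iInter fun k => .iInter fun _ =>
      nullMeasurableSet_le (hX.aemeasurable _) aemeasurable_const
  refine hm.congr ?_
  filter_upwards [hX.cont] with ω hω
  refine propext ?_
  change ω ∈ (⋃ m : ℕ, ⋂ k : ℕ, ⋂ (_ : q k ≤ a), {ω | X (q k) ω ≤ c - 1 / (m + 1 : ℝ)}) ↔
    ∀ t ≤ a, X t ω < c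
  simp only [Set.mem_iUnion, Set.mem_iInter, Set.mem_ofPred_eq]
  constructor
  · rintro ⟨m, h⟩ t ht
    refine (forall_le_of_forall_seq_le hω ha (TopologicalSpace.denseRange_denseSeq _)
      h t ht).trans_lt ?_
    have : (0 : ℝ) < 1 / (m + 1 : ℝ) := by positivity
    linarith
  · intro h
    -- The maximum over the compact interval `[0, a]` is attained, hence bounded away from `c`.
    have hIcc : (Set.Iic a : Set ℝ≥0) = Set.Icc 0 a := by ext; simp
    have hcomp : IsCompact (Set.Iic a : Set ℝ≥0) := hIcc ▸ isCompact_Icc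
    obtain ⟨s, hs, hmax⟩ := hcomp.exists_isMaxOn ⟨a, Set.mem_Iic.2 le_rfl⟩ hω.continuousOn
    obtain ⟨m, hm⟩ := exists_nat_one_div_lt (sub_pos.2 (h s hs))
    refine ⟨m, fun k hk => ?_⟩
    have : X (q k) ω ≤ X s ω := hmax hk
    linarith

/-- A Brownian motion first reaches the level `c` between the times `a` and `b` with positive
probability: it stays below `c / 2` and ends above some `-K` on `[0, a]`, and then makes an
independent increment larger than `K + c` over half of the remaining time. -/
lemma IsBrownianReal.measure_forall_lt_and_exists_pos (hX : IsBrownianReal X P) {a b : ℝ≥0}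
    (ha : a ≠ 0) (hab : a < b) {c : ℝ} (hc : 0 < c) :
    0 < P {ω | (∀ t ≤ a, X t ω < c) ∧ ∃ t < b, c ≤ X t ω} := by
  set q := TopologicalSpace.denseSeq ℝ≥0
  obtain ⟨e, rfl⟩ := le_iff_exists_add.1 hab.le
  have he : 0 < e := pos_of_lt_add_right hab
  have hN := hX.measure_forall_seq_lt_pos ha (half_pos hc) q
  obtain ⟨K, hK⟩ : ∃ K : ℕ,
      P {ω | (∀ k, q k ≤ a → X (q k) ω < c / 2) ∧ -(K : ℝ) ≤ X a ω} ≠ 0 := by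
    by_contra! h
    refine hN.ne' (measure_mono_null (fun ω hω => ?_) (measure_iUnion_null h))
    obtain ⟨K, hK⟩ := exists_nat_ge (-X a ω)
    exact Set.mem_iUnion.2 ⟨K, hω, by linarith⟩
  have hinc : 0 < P {ω | X (a + e / 2) ω - X a ω ∈ Set.Ioi (K + c)} := by
    rw [hX.measure_sub_mem _ _ measurableSet_Ioi]
    refine gaussianReal_pos_of_isOpen ?_ isOpen_Ioi Set.nonempty_Ioi
    rw [Ne, nndist_eq_zero, NNReal.val_eq_coe, NNReal.val_eq_coe, NNReal.coe_inj]
    simpa using he.ne'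
  have hind := (hX.indepFun_shift a).measure_inter_preimage_eq_mul
    {f | f (e / 2) ∈ Set.Ioi (K + c)}
    {g | (∀ k, ∀ h : q k ≤ a, g ⟨q k, h⟩ < c / 2) ∧ -(K : ℝ) ≤ g ⟨a, Set.self_mem_Iic⟩}
    (measurableSet_Ioi.preimage (measurable_pi_apply _)) ?_
  · have hpos := ENNReal.mul_pos hinc.ne' hK
    refine (hpos.trans_eq hind.symm).trans_le (measure_mono_ae ?_)
    filter_upwards [hX.cont] with ω hω ⟨h1, h2, h3⟩
    have h1' : (K : ℝ) + c < X (a + e / 2) ω - X a ω := h1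
    have h3' : -(K : ℝ) ≤ X a ω := h3
    refine ⟨fun t ht => ?_, a + e / 2, by gcongr; exact NNReal.half_lt_self he.ne', by linarith⟩
    have := forall_le_of_forall_seq_le hω ha (TopologicalSpace.denseRange_denseSeq _)
      (fun k hk => (h2 k hk).le) t ht
    linarith
  · simp only [Set.ofPred_and, Set.ofPred_forall]
    refine .inter (.iInter fun k => .iInter fun h => ?_) ?_
    · exact measurableSet_lt (measurable_pi_apply _) measurable_const
    · exact measurableSet_le measurable_const (measurable_pi_apply _)

end Brownian

end ProbabilityTheory

/-! ### Failure of convergence of the discrete probabilities -/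

theorem mainTheorem2 {Ω : Type*} [MeasurableSpace Ω] (P : Measure Ω) [IsProbabilityMeasure P]
    (X : ℝ≥0 → Ω → ℝ) (hX : IsBrownianReal X P)
    {AP : Type*} (p : AP) (B : AP → Set ℝ) (hp : B p = Set.Ici 1) :
    (MTL.psi p).IsMITL ∧
    NullMeasurableSet {ω | MTL.Sat B (fun t => X t ω) (MTL.psi p) 0} P ∧
    P {ω | MTL.Sat B (fun t => X t ω) (MTL.psi p) 0} =
      P {ω | hittingAfter X (B p) 0 ω ∈
        Set.Ioo ((8 : ℝ≥0) : WithTop ℝ≥0) ((9 : ℝ≥0) : WithTop ℝ≥0)} ∧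
    0 < P {ω | MTL.Sat B (fun t => X t ω) (MTL.psi p) 0} ∧
    (∀ n : ℕ, 2 ≤ n → ∀ ω, ¬ MTL.SatDiscrete n B (fun t => X t ω) (MTL.psi p) 0) ∧
    ¬ Tendsto (fun n : ℕ => P {ω | MTL.SatDiscrete n B (fun t => X t ω) (MTL.psi p) 0}) atTop
      (𝓝 (P {ω | MTL.Sat B (fun t => X t ω) (MTL.psi p) 0})) := by
  have hclosed : ∀ᵐ ω ∂P, IsClosed {u | X u ω ∈ B p} := by
    filter_upwards [hX.cont] with ω hω
    rw [hp]
    exact isClosed_Ici.preimage hω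
  have hsat : {ω | MTL.Sat B (fun t => X t ω) (MTL.psi p) 0} =ᵐ[P]
      {ω | (∀ t ≤ 8, X t ω < 1) ∧ ∃ t < 9, 1 ≤ X t ω} := by
    filter_upwards [hclosed] with ω hω
    refine propext ((MTL.sat_psi_iff hω).trans ?_)
    simp only [hp, Set.mem_Ici, not_le]
    rfl
  have hhit : {ω | MTL.Sat B (fun t => X t ω) (MTL.psi p) 0} =ᵐ[P]
      {ω | hittingAfter X (B p) 0 ω ∈
        Set.Ioo ((8 : ℝ≥0) : WithTop ℝ≥0) ((9 : ℝ≥0) : WithTop ℝ≥0)} := by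
    filter_upwards [hclosed] with ω hω
    refine propext ((MTL.sat_psi_iff hω).trans ?_)
    change _ ↔ _ < hittingAfter X (B p) 0 ω ∧ hittingAfter X (B p) 0 ω < _
    rw [hittingAfter_lt_iff]
    refine and_congr ⟨fun h => ?_, fun h u hu => ?_⟩ ⟨?_, ?_⟩
    · rw [hittingAfter]
      split_ifs with hex
      · have hmem := hω.csInf_mem (hex.imp fun _ h => h.2) (OrderBot.bddBelow _)
        simp only [zero_le, true_and]
        exact WithTop.coe_lt_coe.2 (not_le.1 fun hle => h _ hle hmem)
      · exact WithTop.coe_lt_top _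
    · exact notMem_of_lt_hittingAfter ((WithTop.coe_le_coe.2 hu).trans_lt h) zero_le
    · rintro ⟨u, hu, h⟩
      exact ⟨u, ⟨zero_le, hu⟩, h⟩
    · rintro ⟨u, hu, h⟩
      exact ⟨u, hu.2, h⟩
  have hpos : 0 < P {ω | MTL.Sat B (fun t => X t ω) (MTL.psi p) 0} := by
    rw [measure_congr hsat]
    exact hX.measure_forall_lt_and_exists_pos (by norm_num) (by norm_num) one_pos
  have hdisc (n : ℕ) (hn : 2 ≤ n) (ω : Ω) :
      ¬ MTL.SatDiscrete n B (fun t => X t ω) (MTL.psi p) 0 :=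
    MTL.not_satDiscrete_psi hn B _ p
  refine ⟨MTL.isMITL_psi p, ?_, measure_congr hhit, hpos, hdisc, fun hlim => hpos.ne' ?_⟩
  · refine NullMeasurableSet.congr ?_ hsat.symm
    have h9 : {ω | ∃ t < 9, 1 ≤ X t ω} =
        ⋃ k : ℕ, {ω | ∀ t ≤ 9 - 1 / (k + 1 : ℝ≥0), X t ω < 1}ᶜ := by
      ext ω
      simp only [Set.mem_iUnion, Set.mem_compl_iff, Set.mem_ofPred_eq, not_forall, not_lt]
      constructor
      · rintro ⟨t, ht, h⟩
        obtain ⟨k, hk⟩ := exists_nat_one_div_lt (tsub_pos_of_lt ht)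
        exact ⟨k, t, le_tsub_of_add_le_left (lt_tsub_iff_right.1 hk).le, h⟩
      · rintro ⟨k, t, ht, h⟩
        exact ⟨t, ht.trans_lt (tsub_lt_self (by norm_num) (by positivity)), h⟩
    have hm9 : NullMeasurableSet {ω | ∃ t < 9, 1 ≤ X t ω} P := by
      rw [h9]
      refine .iUnion fun k => (hX.nullMeasurableSet_forall_lt ?_ 1).compl
      refine (tsub_pos_of_lt (lt_of_le_of_lt ?_ (by norm_num : (1 : ℝ≥0) < 9))).ne'
      exact div_le_one_of_le₀ (by simp) zero_le
    exact (hX.nullMeasurableSet_forall_lt (by norm_num) 1).inter hm9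
  · refine tendsto_nhds_unique hlim (tendsto_const_nhds.congr' ?_)
    filter_upwards [eventually_ge_atTop 2] with n hn
    simp [hdisc n hn]
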